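/- **Theorem (spectral averaging).** Let $H$ be a complex Hilbert space (for example $\ell^2(\mathbb{Z})$), let $A$ be a bounded self-adjoint operator on $H$, and let $\phi \in H \setminus \{0\}$. For $\lambda \in \mathbb{R}$ let $A_\lambda = A + \lambda \langle \phi, \cdot \rangle \phi$, where the inner product is linear in the second argument, and let $\mu_\lambda$ be the spectral measure of the pair $(A_\lambda, \phi)$, that is, the finite Borel measure on $\mathbb{R}$ with $\langle \phi, g(A_\lambda) \phi \rangle = \int g \, d\mu_\lambda$ for every continuous compactly supported $g : \mathbb{R} \to \mathbb{R}$. Then $$\int \left[ d\mu_\lambda(E) \right] d\lambda = dE$$ in the following sense: for every $f \in L^1(\mathbb{R}, dE)$ (complex-valued), 1. $f \in L^1(\mathbb{R}, d\mu_\lambda)$ for Lebesgue almost every $\lambda \in \mathbb{R}$; 2. the function $\lambda \mapsto \int f(E) \, d\mu_\lambda(E)$ belongs to $L^1(\mathbb{R}, d\lambda)$; and 3. $$\int \left( \int f(E) \, d\mu_\lambda(E) \right) d\lambda = \int f(E) \, dE.$$ -/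

import Mathlib

open MeasureTheory CompactlySupported

noncomputable section

section SpectralMeasure

variable {H : Type*} [NormedAddCommGroup H] [InnerProductSpace ℂ H] [CompleteSpace H]

/-- The positive linear functional `f ↦ ⟨φ, f(A) φ⟩` on real-valued continuous functions on `ℝ`
with compact support, where `f(A)` is the continuous functional calculus of the bounded
self-adjoint operator `A`. (For self-adjoint `A` and real `f` the number `⟨φ, f(A) φ⟩` is real,
so that taking the real part loses nothing.) -/
def spectralFunctional (A : H →L[ℂ] H) (φ : H) : C_c(ℝ, ℝ) →ₚ[ℝ] ℝ :=
  PositiveLinearMap.mk₀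
    { toFun := fun f => (inner ℂ φ (cfc (f : ℝ → ℝ) A φ)).re
      map_add' := by
        intro f g
        have h : cfc ((f + g : C_c(ℝ, ℝ)) : ℝ → ℝ) A = cfc (f : ℝ → ℝ) A + cfc (g : ℝ → ℝ) A :=
          cfc_add (a := A) (f : ℝ → ℝ) (g : ℝ → ℝ) f.continuous.continuousOn
            g.continuous.continuousOn
        rw [h]
        simp
      map_smul' := by
        intro c f
        have h : cfc ((c • f : C_c(ℝ, ℝ)) : ℝ → ℝ) A = c • cfc (f : ℝ → ℝ) A :=
          cfc_smul (a := A) c (f : ℝ → ℝ) f.continuous.continuousOn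
        rw [h]
        simp [inner_smul_right_eq_smul] }
    (by
      intro f hf
      have h : 0 ≤ cfc (f : ℝ → ℝ) A := cfc_nonneg fun x _ => hf x
      exact ((ContinuousLinearMap.nonneg_iff_isPositive _).1 h).re_inner_nonneg_right φ)

/-- The spectral measure of the bounded self-adjoint operator `A` and the vector `φ`: the regular
Borel measure on `ℝ` that the Riesz–Markov–Kakutani theorem associates with `f ↦ ⟨φ, f(A) φ⟩`. -/
def spectralMeasure (A : H →L[ℂ] H) (φ : H) : Measure ℝ :=
  RealRMK.rieszMeasure (spectralFunctional A φ)

/-- The defining property of the spectral measure. -/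
theorem integral_spectralMeasure (A : H →L[ℂ] H) (φ : H) (f : C_c(ℝ, ℝ)) :
    ∫ E, f E ∂(spectralMeasure A φ) = (inner ℂ φ (cfc (f : ℝ → ℝ) A φ)).re :=
  RealRMK.integral_rieszMeasure (spectralFunctional A φ) f

/-- The rank-one perturbation `A + l ⟨φ, ·⟩ φ`. -/
def rankOnePerturbation (A : H →L[ℂ] H) (φ : H) (l : ℝ) : H →L[ℂ] H :=
  A + (l : ℂ) • InnerProductSpace.rankOne ℂ φ φ

end SpectralMeasure

end

open ProbabilityTheory Filter Topology
open scoped ENNReal NNReal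

/-! ### Uniqueness from Cauchy averages -/

/-! Put `z = x + iγ` with `γ > 0` and `F = ⟨φ, (A - z)⁻¹ φ⟩`. The Cauchy average of `μ_l` at
location `x` and scale `γ` is `π⁻¹ Im F_l`, where the rank-one resolvent formula gives `F_l = F / (1
+ l F)`. Hence it equals `π⁻¹ Im F / |1 + l F|²`, which as a function of `l` is again a Cauchy
density, with integral `1` (`exists_lintegral_cauchyPDF_spectralMeasure`). By Tonelli, every Cauchy
average of `∫ μ_l dl` is `1`. Only Lebesgue measure has this property
(`eq_volume_of_lintegral_cauchyPDF`), and Fubini for kernels passes to integrable `f`. -/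

lemma cauchyPDF_comm (x y : ℝ) (γ : ℝ≥0) : cauchyPDF x γ y = cauchyPDF y γ x := by
  simp only [cauchyPDF_def, cauchyPDFReal_def]
  congr 4
  ring

lemma measurable_uncurry_cauchyPDF (γ : ℝ≥0) :
    Measurable fun p : ℝ × ℝ => cauchyPDF p.1 γ p.2 := by
  simp only [cauchyPDF_def, cauchyPDFReal_def]
  fun_prop

lemma intervalIntegral_cauchyPDFReal (x₀ : ℝ) {γ : ℝ≥0} (hγ : γ ≠ 0) (a b : ℝ) :
    ∫ x in a..b, cauchyPDFReal x₀ γ x =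
      Real.pi⁻¹ * (Real.arctan ((b - x₀) / γ) - Real.arctan ((a - x₀) / γ)) := by
  have hγ' : (γ : ℝ) ≠ 0 := by exact_mod_cast hγ
  simp only [cauchyPDFReal_def']
  have h := intervalIntegral.integral_comp_sub_right (a := a) (b := b)
    (fun x : ℝ => (1 + (x / γ) ^ 2)⁻¹) x₀
  have h' := intervalIntegral.integral_comp_div (a := a - x₀) (b := b - x₀)
    (fun x : ℝ => (1 + x ^ 2)⁻¹) hγ'
  rw [intervalIntegral.integral_const_mul, h, h', integral_inv_one_add_sq, NNReal.coe_inv,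
    smul_eq_mul]
  field_simp

/-- Cauchy distributions of scale tending to zero concentrate at their location. -/
lemma tendsto_setLIntegral_Ioc_cauchyPDF {x₀ a b : ℝ} (ha : a < x₀) (hb : x₀ < b) :
    Tendsto (fun n : ℕ => ∫⁻ x in Set.Ioc a b, cauchyPDF x₀ ((n : ℝ≥0) + 1)⁻¹ x) atTop (𝓝 1) := by
  have key : ∀ n : ℕ, ∫⁻ x in Set.Ioc a b, cauchyPDF x₀ ((n : ℝ≥0) + 1)⁻¹ x =
      ENNReal.ofReal (Real.pi⁻¹ * (Real.arctan ((b - x₀) * ((n : ℝ) + 1)) -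
        Real.arctan ((a - x₀) * ((n : ℝ) + 1)))) := by
    intro n
    have hn : ((n : ℝ≥0) + 1)⁻¹ ≠ 0 := by positivity
    have h := intervalIntegral_cauchyPDFReal x₀ hn a b
    rw [intervalIntegral.integral_of_le (by linarith)] at h
    simp only [cauchyPDF_def]
    rw [← ofReal_integral_eq_lintegral_ofReal (integrable_cauchyPDFReal x₀).integrableOn
      (ae_of_all _ fun x => (cauchyPDF_pos x₀ hn x).le), h]
    simp
  simp only [key]
  rw [← ENNReal.ofReal_one]
  refine ENNReal.tendsto_ofReal ?_
  have hn : Tendsto (fun n : ℕ => (n : ℝ) + 1) atTop atTop :=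
    tendsto_atTop_add_const_right _ _ tendsto_natCast_atTop_atTop
  have h1 : Tendsto (fun n : ℕ => Real.arctan ((b - x₀) * ((n : ℝ) + 1))) atTop
      (𝓝 (Real.pi / 2)) :=
    (tendsto_nhds_of_tendsto_nhdsWithin Real.tendsto_arctan_atTop).comp
      (hn.const_mul_atTop (by linarith))
  have h2 : Tendsto (fun n : ℕ => Real.arctan ((a - x₀) * ((n : ℝ) + 1))) atTop
      (𝓝 (-(Real.pi / 2))) :=
    (tendsto_nhds_of_tendsto_nhdsWithin Real.tendsto_arctan_atBot).comp
      (hn.const_mul_atTop_of_neg (by linarith))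
  have h3 := (h1.sub h2).const_mul Real.pi⁻¹
  convert h3 using 2
  field_simp
  ring

/-- Mass concentrates at `E` as the scale shrinks. An inequality is enough for Fatou, so boundary
points of `U` need no care. -/
lemma indicator_le_liminf_setLIntegral_cauchyPDF {U : Set ℝ} (hU : IsOpen U) (E : ℝ) :
    U.indicator 1 E ≤
      liminf (fun n : ℕ => ∫⁻ x in U, cauchyPDF x ((n : ℝ≥0) + 1)⁻¹ E) atTop := by
  by_cases hE : E ∈ U
  · obtain ⟨δ, hδ, hδU⟩ := Metric.isOpen_iff.1 hU E hE
    have hsub : Set.Ioc (E - δ / 2) (E + δ / 2) ⊆ U := by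
      intro x hx
      apply hδU
      rw [Metric.mem_ball, Real.dist_eq, abs_lt]
      constructor <;> linarith [hx.1, hx.2]
    rw [Set.indicator_of_mem hE, Pi.one_apply,
      ← (tendsto_setLIntegral_Ioc_cauchyPDF (x₀ := E) (a := E - δ / 2) (b := E + δ / 2)
        (by linarith) (by linarith)).liminf_eq]
    refine liminf_le_liminf (Eventually.of_forall fun n => ?_)
    simp only [cauchyPDF_comm _ E]
    exact lintegral_mono_set hsub
  · simp [Set.indicator_of_notMem hE]

lemma lintegral_setLIntegral_cauchyPDF {ν : Measure ℝ} [SFinite ν] {γ : ℝ≥0}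
    (h : ∀ x : ℝ, ∫⁻ E, cauchyPDF x γ E ∂ν = 1) (U : Set ℝ) :
    ∫⁻ E, (∫⁻ x in U, cauchyPDF x γ E) ∂ν = volume U := by
  have hm : Measurable (Function.uncurry fun E x : ℝ => cauchyPDF x γ E) := by
    simp only [fun E x : ℝ => cauchyPDF_comm x E γ]
    exact measurable_uncurry_cauchyPDF γ
  rw [lintegral_lintegral_swap hm.aemeasurable]
  simp [h]

lemma measurable_setLIntegral_cauchyPDF (γ : ℝ≥0) (U : Set ℝ) :
    Measurable fun E : ℝ => ∫⁻ x in U, cauchyPDF x γ E :=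
  (measurable_uncurry_cauchyPDF γ).lintegral_prod_left'

/-- A measure all of whose Cauchy averages are `1` is bounded by Lebesgue measure. -/
lemma le_volume_of_lintegral_cauchyPDF {ν : Measure ℝ} [SFinite ν]
    (h : ∀ x : ℝ, ∀ γ : ℝ≥0, γ ≠ 0 → ∫⁻ E, cauchyPDF x γ E ∂ν = 1) : ν ≤ volume := by
  have hopen : ∀ U : Set ℝ, IsOpen U → ν U ≤ volume U := by
    intro U hU
    let Q : ℕ → ℝ → ℝ≥0∞ := fun n E => ∫⁻ x in U, cauchyPDF x ((n : ℝ≥0) + 1)⁻¹ E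
    have hQ : ∀ n, ∫⁻ E, Q n E ∂ν = volume U := fun n =>
      lintegral_setLIntegral_cauchyPDF (fun x => h x ((n : ℝ≥0) + 1)⁻¹ (by positivity)) U
    calc ν U = ∫⁻ E, U.indicator 1 E ∂ν := by rw [lintegral_indicator_one hU.measurableSet]
      _ ≤ ∫⁻ E, liminf (fun n => Q n E) atTop ∂ν :=
        lintegral_mono (indicator_le_liminf_setLIntegral_cauchyPDF hU)
      _ ≤ liminf (fun n => ∫⁻ E, Q n E ∂ν) atTop :=
        lintegral_liminf_le fun n => measurable_setLIntegral_cauchyPDF _ U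
      _ = volume U := by simp [hQ]
  refine Measure.le_intro fun s _ _ => ?_
  -- Outer regularity is needed for `volume` only, so nothing is assumed about the regularity of
  -- `ν`.
  rw [s.measure_eq_iInf_isOpen volume]
  exact le_iInf₂ fun U hsU => le_iInf fun hU => (measure_mono hsU).trans (hopen U hU)

/-- The deficits of `∫ p` on `s` and on `sᶜ` are nonnegative and cancel in total, so both vanish.
The density `p`, neither `0` nor `∞`, can then be divided out. -/
lemma eq_of_le_of_lintegral_eq {α : Type*} [MeasurableSpace α] {μ ν : Measure α} {p : α → ℝ≥0∞}
    (hle : ν ≤ μ) (hp : Measurable p) (h0 : ∀ x, p x ≠ 0) (htop : ∀ x, p x ≠ ∞)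
    (hfin : ∫⁻ x, p x ∂ν ≠ ∞) (heq : ∫⁻ x, p x ∂ν = ∫⁻ x, p x ∂μ) : ν = μ := by
  have hset : ∀ s : Set α, ∫⁻ x in s, p x ∂ν ≤ ∫⁻ x in s, p x ∂μ := fun s =>
    lintegral_mono' (Measure.restrict_mono le_rfl hle) le_rfl
  have key : ν.withDensity p = μ.withDensity p := by
    ext s hs
    rw [withDensity_apply _ hs, withDensity_apply _ hs]
    refine (hset s).antisymm ?_
    have h1 := lintegral_add_compl (μ := ν) p hs
    have h2 := lintegral_add_compl (μ := μ) p hs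
    have hc : ∫⁻ x in sᶜ, p x ∂ν ≠ ∞ := ne_top_of_le_ne_top hfin (setLIntegral_le_lintegral _ _)
    refine (ENNReal.add_le_add_iff_right hc).1 ?_
    rw [h1, heq, ← h2]
    gcongr
  rw [← withDensity_inv_same (μ := ν) hp (ae_of_all _ h0) (ae_of_all _ htop), key,
    withDensity_inv_same (μ := μ) hp (ae_of_all _ h0) (ae_of_all _ htop)]

/-- Lebesgue measure is the only measure all of whose Cauchy averages are `1`. -/
lemma eq_volume_of_lintegral_cauchyPDF {ν : Measure ℝ} [SFinite ν]
    (h : ∀ x : ℝ, ∀ γ : ℝ≥0, γ ≠ 0 → ∫⁻ E, cauchyPDF x γ E ∂ν = 1) : ν = volume := by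
  refine eq_of_le_of_lintegral_eq (le_volume_of_lintegral_cauchyPDF h)
    (measurable_cauchyPDF 0 1) (fun x => ?_) (fun x => ?_) ?_ ?_
  · simp [cauchyPDF_def, cauchyPDF_pos 0 one_ne_zero x]
  · simp [cauchyPDF_def]
  · simp [h 0 1 one_ne_zero]
  · rw [h 0 1 one_ne_zero, lintegral_cauchyPDF_eq_one 0 one_ne_zero]

section SpectralAveraging

variable {H : Type*} [NormedAddCommGroup H] [InnerProductSpace ℂ H] [CompleteSpace H]

/-! ### The spectral measure integrates continuous functions -/

/-- A continuous function equal to `1` on `[-n, n]` and to `0` outside `[-n - 1, n + 1]`. -/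
noncomputable def plateau (n : ℕ) : C_c(ℝ, ℝ) where
  toFun x := max 0 (min 1 (n + 1 - |x|))
  continuous_toFun := by fun_prop
  hasCompactSupport' := by
    refine HasCompactSupport.intro (isCompact_Icc (a := -((n : ℝ) + 1)) (b := n + 1)) fun x hx => ?_
    have : (n : ℝ) + 1 < |x| := by
      by_contra! h
      exact hx (abs_le.1 h)
    exact max_eq_left ((min_le_right _ _).trans (by linarith))

lemma plateau_apply (n : ℕ) (x : ℝ) : plateau n x = max 0 (min 1 (n + 1 - |x|)) := rfl

lemma plateau_nonneg (n : ℕ) (x : ℝ) : 0 ≤ plateau n x := le_max_left _ _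

lemma plateau_eq_one {n : ℕ} {x : ℝ} (h : |x| ≤ n) : plateau n x = 1 := by
  rw [plateau_apply, min_eq_left (by linarith)]
  simp

lemma plateau_mono (x : ℝ) : Monotone fun n : ℕ => plateau n x := by
  intro m n hmn
  have : (m : ℝ) ≤ n := by exact_mod_cast hmn
  simp only [plateau_apply]
  gcongr

lemma lintegral_compactlySupported_spectralMeasure (A : H →L[ℂ] H) (φ : H) (f : C_c(ℝ, ℝ))
    (hf : ∀ x, 0 ≤ f x) :
    ∫⁻ E, ENNReal.ofReal (f E) ∂(spectralMeasure A φ) =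
      ENNReal.ofReal (inner ℂ φ (cfc (f : ℝ → ℝ) A φ)).re := by
  have : (spectralMeasure A φ).Regular := by unfold spectralMeasure; infer_instance
  rw [← integral_spectralMeasure]
  exact (ofReal_integral_eq_lintegral_ofReal
    (f.continuous.integrable_of_hasCompactSupport f.hasCompactSupport) (ae_of_all _ hf)).symm

/-- Needed for constants and Cauchy densities, which lack compact support. Truncations of `g`
converge monotonically under the integral, while `cfc` sees only the bounded spectrum and is
eventually constant. -/
lemma lintegral_continuous_spectralMeasure (A : H →L[ℂ] H) (φ : H)
    {g : ℝ → ℝ} (hg : Continuous g) (hg0 : ∀ x, 0 ≤ g x) :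
    ∫⁻ E, ENNReal.ofReal (g E) ∂(spectralMeasure A φ) =
      ENNReal.ofReal (inner ℂ φ (cfc g A φ)).re := by
  -- The factor `‖1‖` is kept because it is `0` when `H` is trivial.
  obtain ⟨N, hN⟩ := exists_nat_ge (‖A‖ * ‖(1 : H →L[ℂ] H)‖)
  let G : ℕ → C_c(ℝ, ℝ) := fun n =>
    { toFun := fun x => g x * plateau n x
      continuous_toFun := hg.mul (plateau n).continuous
      hasCompactSupport' := (plateau n).hasCompactSupport.mul_left }
  have hG : ∀ n x, G n x = g x * plateau n x := fun _ _ => rfl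
  have hlim : Tendsto (fun n => ∫⁻ E, ENNReal.ofReal (G n E) ∂(spectralMeasure A φ)) atTop
      (𝓝 (∫⁻ E, ENNReal.ofReal (g E) ∂(spectralMeasure A φ))) := by
    refine lintegral_tendsto_of_tendsto_of_monotone
      (fun n => (G n).continuous.measurable.ennreal_ofReal.aemeasurable)
      (ae_of_all _ fun x m n hmn => ENNReal.ofReal_le_ofReal
        (mul_le_mul_of_nonneg_left (plateau_mono x hmn) (hg0 x)))
      (ae_of_all _ fun x => ?_)
    obtain ⟨M, hM⟩ := exists_nat_ge |x|
    refine tendsto_atTop_of_eventually_const (i₀ := M) fun n hn => ?_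
    rw [hG, plateau_eq_one (hM.trans (by exact_mod_cast hn)), mul_one]
  refine tendsto_nhds_unique hlim (tendsto_atTop_of_eventually_const (i₀ := N) fun n hn => ?_)
  rw [lintegral_compactlySupported_spectralMeasure A φ (G n)
    fun x => mul_nonneg (hg0 x) (plateau_nonneg n x)]
  congr 4
  refine cfc_congr fun x hx => ?_
  have hx' : |x| ≤ n := by
    have := spectrum.subset_closedBall_norm_mul (𝕜 := ℝ) A hx
    rw [mem_closedBall_zero_iff, Real.norm_eq_abs] at this
    exact this.trans (hN.trans (by exact_mod_cast hn))
  simp [hG, plateau_eq_one hx']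

lemma spectralMeasure_univ {A : H →L[ℂ] H} (hA : IsSelfAdjoint A) (φ : H) :
    spectralMeasure A φ Set.univ = ENNReal.ofReal (‖φ‖ ^ 2) := by
  have h := lintegral_continuous_spectralMeasure A φ (g := fun _ => (1 : ℝ)) continuous_const
    (fun _ => zero_le_one)
  rw [cfc_const_one ℝ A] at h
  simpa [inner_self_eq_norm_sq_to_K, ← Complex.ofReal_pow] using h

lemma isFiniteMeasure_spectralMeasure {A : H →L[ℂ] H} (hA : IsSelfAdjoint A) (φ : H) :
    IsFiniteMeasure (spectralMeasure A φ) :=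
  ⟨by simp [spectralMeasure_univ hA]⟩

/-! ### Cauchy averages of the spectral measures -/

lemma exists_sub_smul_apply_eq {A : H →L[ℂ] H} (hA : IsSelfAdjoint A) {z : ℂ} (hz : z.im ≠ 0)
    (φ : H) : ∃ ψ : H, A ψ - z • ψ = φ := by
  have hmem : z ∉ spectrum ℂ A := fun h => hz (by rw [hA.mem_spectrum_eq_re h, Complex.ofReal_im])
  rw [spectrum.notMem_iff] at hmem
  obtain ⟨u, hu⟩ := hmem
  -- The unit `u` is `z - A`, hence the sign.
  refine ⟨-((↑u⁻¹ : H →L[ℂ] H) φ), ?_⟩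
  have h : (u : H →L[ℂ] H) ((↑u⁻¹ : H →L[ℂ] H) φ) = φ := by
    exact DFunLike.congr_fun u.mul_inv φ
  rw [hu, Algebra.algebraMap_eq_smul_one] at h
  change z • ((↑u⁻¹ : H →L[ℂ] H) φ) - A ((↑u⁻¹ : H →L[ℂ] H) φ) = φ at h
  rw [map_neg, smul_neg, neg_sub_neg, h]

lemma continuous_cauchyPDFReal (x : ℝ) {γ : ℝ≥0} (hγ : γ ≠ 0) :
    Continuous (cauchyPDFReal x γ) := by
  have hγ' : (0 : ℝ) < γ := by exact_mod_cast pos_iff_ne_zero.2 hγ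
  have : cauchyPDFReal x γ = fun t => Real.pi⁻¹ * γ * ((t - x) ^ 2 + γ ^ 2)⁻¹ := rfl
  rw [this]
  exact continuous_const.mul (Continuous.inv₀ (by fun_prop) fun t => by positivity)

lemma cfc_cauchyPDFReal_mul {T : H →L[ℂ] H} (hT : IsSelfAdjoint T) (x : ℝ) {γ : ℝ≥0}
    (hγ : γ ≠ 0) :
    cfc (cauchyPDFReal x γ) T * ((T - x • 1) * (T - x • 1) + ((γ : ℝ) ^ 2) • 1) =
      (Real.pi⁻¹ * (γ : ℝ)) • 1 := by
  have hγ' : (0 : ℝ) < γ := by exact_mod_cast pos_iff_ne_zero.2 hγ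
  have hS : cfc (fun t : ℝ => t - x) T = T - x • 1 := by
    rw [cfc_sub (a := T) (fun t : ℝ => t) (fun _ => x), cfc_id' ℝ T, cfc_const x T,
      Algebra.algebraMap_eq_smul_one]
  have hD : cfc (fun t : ℝ => (t - x) * (t - x) + (γ : ℝ) ^ 2) T =
      (T - x • 1) * (T - x • 1) + ((γ : ℝ) ^ 2) • 1 := by
    rw [cfc_add (a := T) (fun t : ℝ => (t - x) * (t - x)) (fun _ => (γ : ℝ) ^ 2),
      cfc_mul (a := T) (fun t : ℝ => t - x) (fun t : ℝ => t - x), hS, cfc_const _ T,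
      Algebra.algebraMap_eq_smul_one]
  rw [← hD, ← cfc_mul (a := T) _ _ (continuous_cauchyPDFReal x hγ).continuousOn,
    ← Algebra.algebraMap_eq_smul_one, ← cfc_const _ T]
  refine cfc_congr fun t _ => ?_
  have : (t - x) ^ 2 + (γ : ℝ) ^ 2 ≠ 0 := by positivity
  simp only [cauchyPDFReal_def]
  field_simp

/-- With `S = T - x` and `B = π⁻¹ γ (S² + γ²)⁻¹`, which commutes with `S`, one has `φ = (S - iγ) ψ`.
So `⟨φ, B φ⟩ = ⟨ψ, B (S² + γ²) ψ⟩ = π⁻¹ γ ‖ψ‖²`. -/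
lemma re_inner_cfc_cauchyPDFReal {T : H →L[ℂ] H} (hT : IsSelfAdjoint T) (x : ℝ) {γ : ℝ≥0}
    (hγ : γ ≠ 0) {φ ψ : H} (hψ : T ψ - (⟨x, γ⟩ : ℂ) • ψ = φ) :
    (inner ℂ φ (cfc (cauchyPDFReal x γ) T φ)).re = Real.pi⁻¹ * (γ * ‖ψ‖ ^ 2) := by
  have hmul := cfc_cauchyPDFReal_mul hT x hγ
  have hcomm : Commute (cfc (cauchyPDFReal x γ) T) (T - x • 1) :=
    Commute.sub_right ((Commute.refl T).cfc_real _) ((Commute.one_right _).smul_right x)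
  have hS : IsSelfAdjoint (T - x • (1 : H →L[ℂ] H)) :=
    hT.sub ((IsSelfAdjoint.all x).smul (IsSelfAdjoint.one _))
  have hφ : φ = (T - x • (1 : H →L[ℂ] H)) ψ - (γ * Complex.I : ℂ) • ψ := by
    rw [← hψ]
    have : (⟨x, γ⟩ : ℂ) = (x : ℂ) + γ * Complex.I := by
      apply Complex.ext <;> simp
    rw [this, add_smul, ← sub_sub]
    rfl
  generalize T - x • (1 : H →L[ℂ] H) = S at *
  generalize cfc (cauchyPDFReal x γ) T = B at *
  have hSsymm : ∀ u v : H, inner ℂ (S u) v = inner ℂ u (S v) :=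
    (ContinuousLinearMap.isSelfAdjoint_iff_isSymmetric.1 hS)
  have hSB : S (B ψ) = B (S ψ) := (DFunLike.congr_fun hcomm.eq ψ).symm
  have hSB' : S (B (S ψ)) = B (S (S ψ)) := (DFunLike.congr_fun hcomm.eq (S ψ)).symm
  have hm : B (S (S ψ)) + ((γ : ℂ) ^ 2) • B ψ = ((Real.pi⁻¹ * (γ : ℝ) : ℝ) : ℂ) • ψ := by
    have h := DFunLike.congr_fun hmul ψ
    have h' : B (S (S ψ) + ((γ : ℝ) ^ 2) • ψ) = (Real.pi⁻¹ * (γ : ℝ)) • ψ := h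
    rw [map_add, ← Complex.coe_smul, ← Complex.coe_smul, map_smul] at h'
    exact_mod_cast h'
  have hmain : inner ℂ φ (B φ) = inner ℂ ψ (B (S (S ψ)) + ((γ : ℂ) ^ 2) • B ψ) := by
    rw [hφ]
    simp only [map_sub, map_smul, inner_sub_left, inner_sub_right, inner_smul_left,
      inner_smul_right, inner_add_right, hSsymm, hSB, hSB', map_mul, Complex.conj_I,
      Complex.conj_ofReal]
    linear_combination (-(γ : ℂ) ^ 2 * inner ℂ ψ (B ψ)) * Complex.I_sq
  rw [hmain, hm, inner_smul_right, inner_self_eq_norm_sq_to_K, Complex.re_ofReal_mul,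
    mul_assoc]
  norm_cast

lemma isSelfAdjoint_rankOnePerturbation {A : H →L[ℂ] H} (hA : IsSelfAdjoint A) (φ : H) (l : ℝ) :
    IsSelfAdjoint (rankOnePerturbation A φ l) := by
  refine hA.add (IsSelfAdjoint.smul (Complex.conj_ofReal l) ?_)
  exact (InnerProductSpace.isPositive_rankOne_self φ).isSelfAdjoint

/-- Since `⟨A ψ, ψ⟩` is real, only the `z` term contributes. This trades `γ ‖ψ‖²` for `Im F`. -/
lemma im_inner_of_sub_smul_apply_eq {A : H →L[ℂ] H} (hA : IsSelfAdjoint A) {z : ℂ} {φ ψ : H}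
    (hψ : A ψ - z • ψ = φ) : (inner ℂ φ ψ).im = z.im * ‖ψ‖ ^ 2 := by
  have hreal : (inner ℂ (A ψ) ψ).im = 0 :=
    (ContinuousLinearMap.isSelfAdjoint_iff_isSymmetric.1 hA).im_inner_apply_self ψ
  rw [← hψ, inner_sub_left, inner_smul_left, inner_self_eq_norm_sq_to_K, Complex.sub_im, hreal]
  simp [← Complex.ofReal_pow]

omit [CompleteSpace H] in
/-- The resolvent equation for a rank-one perturbation. -/
lemma rankOnePerturbation_sub_smul_apply {A : H →L[ℂ] H} {z : ℂ} {φ ψ : H}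
    (hψ : A ψ - z • ψ = φ) {l : ℝ} (hl : 1 + l * inner ℂ φ ψ ≠ 0) :
    rankOnePerturbation A φ l ((1 + l * inner ℂ φ ψ)⁻¹ • ψ) -
      z • ((1 + l * inner ℂ φ ψ)⁻¹ • ψ) = φ := by
  have h : (1 + l * inner ℂ φ ψ)⁻¹ • (A ψ - z • ψ + (l * inner ℂ φ ψ) • φ) = φ := by
    rw [hψ]
    nth_rewrite 2 [← one_smul ℂ φ]
    rw [← add_smul, smul_smul, inv_mul_cancel₀ hl, one_smul]
  have happ : rankOnePerturbation A φ l ψ = A ψ + (l : ℂ) • (inner ℂ φ ψ • φ) := rfl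
  rw [map_smul, happ, smul_comm z, ← smul_sub, smul_smul (l : ℂ), add_sub_right_comm]
  exact h

/-- The Cauchy averages of the spectral measures of `A + l ⟨φ, ·⟩ φ` form, as a function of `l`,
a Cauchy density. -/
lemma exists_lintegral_cauchyPDF_spectralMeasure {A : H →L[ℂ] H} (hA : IsSelfAdjoint A) {φ : H}
    (hφ : φ ≠ 0) (x : ℝ) {γ : ℝ≥0} (hγ : γ ≠ 0) :
    ∃ x₀ : ℝ, ∃ r : ℝ≥0, r ≠ 0 ∧ ∀ l : ℝ,
      ∫⁻ E, cauchyPDF x γ E ∂(spectralMeasure (rankOnePerturbation A φ l) φ) =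
        cauchyPDF x₀ r l := by
  have hγ' : (0 : ℝ) < γ := by exact_mod_cast pos_iff_ne_zero.2 hγ
  obtain ⟨ψ, hψ⟩ := exists_sub_smul_apply_eq hA (z := ⟨x, γ⟩) hγ'.ne' φ
  have hψ0 : ψ ≠ 0 := by
    rintro rfl
    exact hφ (by simpa using hψ.symm)
  set F : ℂ := inner ℂ φ ψ with hF
  have him : F.im = γ * ‖ψ‖ ^ 2 := im_inner_of_sub_smul_apply_eq hA hψ
  have him_pos : 0 < F.im := by
    rw [him]
    have := norm_pos_iff.2 hψ0
    positivity
  have hden : ∀ l : ℝ, 1 + (l : ℂ) * F ≠ 0 := by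
    intro l h
    have h1 := congrArg Complex.im h
    have h2 := congrArg Complex.re h
    simp only [Complex.add_im, Complex.one_im, Complex.im_ofReal_mul, zero_add, Complex.zero_im,
      mul_eq_zero, him_pos.ne', or_false] at h1
    simp [h1] at h2
  have hN : 0 < F.re ^ 2 + F.im ^ 2 := by positivity
  -- Location and scale are the real and imaginary parts of `-1 / F`, because `|1 + l F|² = |F|² |l
  -- + 1 / F|²`.
  refine ⟨-F.re / (F.re ^ 2 + F.im ^ 2), (F.im / (F.re ^ 2 + F.im ^ 2)).toNNReal, ?_,
    fun l => ?_⟩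
  · exact (Real.toNNReal_pos.2 (div_pos him_pos hN)).ne'
  have hT := isSelfAdjoint_rankOnePerturbation hA φ l
  have hc := continuous_cauchyPDFReal x hγ
  simp only [cauchyPDF_def]
  rw [lintegral_continuous_spectralMeasure _ _ hc fun t => (cauchyPDF_pos x hγ t).le,
    re_inner_cfc_cauchyPDFReal hT x hγ (rankOnePerturbation_sub_smul_apply hψ (hden l)),
    cauchyPDFReal_def, norm_smul, mul_pow, norm_inv, inv_pow, ← Complex.normSq_eq_norm_sq,
    Complex.normSq_apply, mul_left_comm (γ : ℝ), ← him, ← hF]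
  congr 1
  have h1 : (1 + l * F.re) ^ 2 + (l * F.im) ^ 2 ≠ 0 := by
    by_cases hl : l = 0
    · simp [hl]
    · positivity
  have h2 : ((l - -F.re / (F.re ^ 2 + F.im ^ 2)) ^ 2 + (F.im / (F.re ^ 2 + F.im ^ 2)) ^ 2) =
      ((1 + l * F.re) ^ 2 + (l * F.im) ^ 2) / (F.re ^ 2 + F.im ^ 2) := by
    field_simp
    ring
  simp only [Real.coe_toNNReal _ (div_pos him_pos hN).le, h2, Complex.add_re, Complex.one_re, Complex.re_ofReal_mul,
    Complex.add_im, Complex.one_im, Complex.im_ofReal_mul, zero_add, ← pow_two]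
  field_simp

/-! ### The spectral measures as a kernel -/

lemma continuous_re_inner_cfc_rankOnePerturbation {A : H →L[ℂ] H} (hA : IsSelfAdjoint A) (φ : H)
    {g : ℝ → ℝ} (hg : Continuous g) :
    Continuous fun l : ℝ => (inner ℂ φ (cfc g (rankOnePerturbation A φ l) φ)).re := by
  have h : Continuous fun l : ℝ => cfc g (rankOnePerturbation A φ l) :=
    Continuous.cfc_of_mem_nhdsSet g (s := Set.univ) Filter.univ_mem
      (by unfold rankOnePerturbation; fun_prop)
      (fun l => isSelfAdjoint_rankOnePerturbation hA φ l) hg.continuousOn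
  exact Complex.continuous_re.comp (continuous_const.inner (h.clm_apply continuous_const))

lemma measurable_spectralMeasure_Ioo {A : H →L[ℂ] H} (hA : IsSelfAdjoint A) (φ : H) (a b : ℝ) :
    Measurable fun l : ℝ => spectralMeasure (rankOnePerturbation A φ l) φ (Set.Ioo a b) := by
  -- Continuous functions increasing to the indicator of `Ioo a b`. Their integrals are continuous
  -- in `l`, so the limit is measurable.
  let g : ℕ → ℝ → ℝ := fun n t => min 1 (n * max 0 (min (t - a) (b - t)))
  have hg : ∀ n, Continuous (g n) := fun n => by fun_prop
  have hg0 : ∀ n t, 0 ≤ g n t := fun n t => by positivity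
  have hlim : ∀ l : ℝ, Tendsto
      (fun n => ENNReal.ofReal (inner ℂ φ (cfc (g n) (rankOnePerturbation A φ l) φ)).re) atTop
      (𝓝 (spectralMeasure (rankOnePerturbation A φ l) φ (Set.Ioo a b))) := by
    intro l
    simp_rw [← fun n => lintegral_continuous_spectralMeasure (rankOnePerturbation A φ l) φ (hg n)
      (hg0 n)]
    rw [← lintegral_indicator_one measurableSet_Ioo]
    refine lintegral_tendsto_of_tendsto_of_monotone
      (fun n => (hg n).measurable.ennreal_ofReal.aemeasurable)
      (ae_of_all _ fun t m n hmn => ENNReal.ofReal_le_ofReal ?_)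
      (ae_of_all _ fun t => ?_)
    · have : (m : ℝ) ≤ n := by exact_mod_cast hmn
      simp only [g]
      gcongr
    · by_cases ht : t ∈ Set.Ioo a b
      · have hpos : 0 < min (t - a) (b - t) := lt_min (by linarith [ht.1]) (by linarith [ht.2])
        obtain ⟨N, hN⟩ := exists_nat_ge (1 / min (t - a) (b - t))
        refine tendsto_atTop_of_eventually_const (i₀ := N) fun n hn => ?_
        have h1 : 1 / min (t - a) (b - t) ≤ n := hN.trans (by exact_mod_cast hn)
        rw [div_le_iff₀ hpos] at h1
        simp [g, max_eq_right hpos.le, min_eq_left h1, ht]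
      · have hneg : min (t - a) (b - t) ≤ 0 := by
          by_contra! h
          rw [lt_min_iff] at h
          exact ht ⟨by linarith [h.1], by linarith [h.2]⟩
        simp [g, max_eq_left hneg, Set.indicator_of_notMem ht]
  refine measurable_of_tendsto_metrizable (fun n => ?_) (tendsto_pi_nhds.2 hlim)
  exact (continuous_re_inner_cfc_rankOnePerturbation hA φ (hg n)).measurable.ennreal_ofReal

lemma measurable_spectralMeasure {A : H →L[ℂ] H} (hA : IsSelfAdjoint A) (φ : H) :
    Measurable fun l : ℝ => spectralMeasure (rankOnePerturbation A φ l) φ := by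
  have hT := isSelfAdjoint_rankOnePerturbation hA φ
  have := fun l => isFiniteMeasure_spectralMeasure (hT l) φ
  refine Measurable.measure_of_isPiSystem
    (Real.borelSpace.measurable_eq.trans Real.borel_eq_generateFrom_Ioo_rat)
    Real.isPiSystem_Ioo_rat (fun s hs => ?_) ?_
  · simp only [Set.mem_iUnion, Set.mem_singleton_iff] at hs
    obtain ⟨a, b, _, rfl⟩ := hs
    exact measurable_spectralMeasure_Ioo hA φ a b
  · simp only [fun l => spectralMeasure_univ (hT l) φ]
    exact measurable_const

/-- The kernel sending `l` to the spectral measure of `A + l ⟨φ, ·⟩ φ` and `φ`. -/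
noncomputable def spectralKernel {A : H →L[ℂ] H} (hA : IsSelfAdjoint A) (φ : H) : Kernel ℝ ℝ where
  toFun l := spectralMeasure (rankOnePerturbation A φ l) φ
  measurable' := measurable_spectralMeasure hA φ

lemma spectralKernel_apply {A : H →L[ℂ] H} (hA : IsSelfAdjoint A) (φ : H) (l : ℝ) :
    spectralKernel hA φ l = spectralMeasure (rankOnePerturbation A φ l) φ := rfl

instance {A : H →L[ℂ] H} (hA : IsSelfAdjoint A) (φ : H) : IsFiniteKernel (spectralKernel hA φ) :=
  ⟨⟨ENNReal.ofReal (‖φ‖ ^ 2), ENNReal.ofReal_lt_top, fun l =>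
    (spectralMeasure_univ (isSelfAdjoint_rankOnePerturbation hA φ l) φ).le⟩⟩

/-- Spectral averaging, as an identity of measures. -/
lemma spectralKernel_comp_volume {A : H →L[ℂ] H} (hA : IsSelfAdjoint A) {φ : H} (hφ : φ ≠ 0) :
    (spectralKernel hA φ ∘ₖ Kernel.const Unit (volume : Measure ℝ)) () = volume := by
  refine eq_volume_of_lintegral_cauchyPDF fun x γ hγ => ?_
  obtain ⟨x₀, r, hr, h⟩ := exists_lintegral_cauchyPDF_spectralMeasure hA hφ x hγ
  -- The average over `E` is taken first, which leaves a Cauchy density in `l`.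
  rw [Kernel.lintegral_comp _ _ _ (measurable_cauchyPDF x γ)]
  simp only [Kernel.const_apply, spectralKernel_apply, h]
  exact lintegral_cauchyPDF_eq_one x₀ hr

end SpectralAveraging

theorem theoremt {H : Type*} [NormedAddCommGroup H] [InnerProductSpace ℂ H] [CompleteSpace H]
    (A : H →L[ℂ] H) (hA : IsSelfAdjoint A) (φ : H) (hφ : φ ≠ 0)
    (f : ℝ → ℂ) (hf : Integrable f volume) :
    (∀ᵐ l : ℝ, Integrable f (spectralMeasure (rankOnePerturbation A φ l) φ)) ∧
    Integrable (fun l : ℝ => ∫ E, f E ∂(spectralMeasure (rankOnePerturbation A φ l) φ)) volume ∧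
    ∫ l : ℝ, (∫ E, f E ∂(spectralMeasure (rankOnePerturbation A φ l) φ)) = ∫ E : ℝ, f E := by
  have hvol := spectralKernel_comp_volume hA hφ
  have hf' : Integrable f
      ((spectralKernel hA φ ∘ₖ Kernel.const Unit (volume : Measure ℝ)) ()) := by rwa [hvol]
  -- All three claims are Fubini for the composed kernel, whose total measure is Lebesgue measure.
  refine ⟨hf'.ae_of_comp, hf'.integral_comp, ?_⟩
  have h := Kernel.integral_comp hf'
  rw [hvol] at h
  exact h.symm
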